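/- The \emph{clocked $\lambda$-calculus} has as terms the finite and infinite terms (modulo $\alpha$-equivalence) built from variables, application, abstraction and a unary symbol $\tau$, and the rules $(\lambda x.M)N \to \tau(M[x:=N])$ and $\tau(M)\,N \to \tau(M N)$, applied in any context. For a $\lambda$-term $M$, the \emph{clocked Lévy tree} $\mathsf{cLL}(M)$ is the infinitary normal form of $M$: the normal form $T$ of the clocked $\lambda$-calculus to which $M$ reduces by an infinitary (strongly convergent) reduction. Let $=_\tau$ be the equivalence closure of the one-step relation given by the rule $\tau(M)\to M$, applied in any context; so $T =_\tau S$ iff $T$ and $S$ differ by inserting and removing finitely many $\tau$'s. $M$ and $N$ \emph{eventually match} if $\mathsf{cLL}(M) =_\tau \mathsf{cLL}(N)$. A $\beta$-redex $(\lambda x.P)Q$ is \emph{simple} if $x$ has at most one free occurrence in $P$ or $Q$ is a $\beta$-normal form. \emph{Simple terms} are defined coinductively: a finite $\lambda$-term $M$ is simple if (a) $M$ has no weak head normal form, or (b) $M$ reduces by weak head reduction, contracting only simple redexes, to $\lambda x.M'$ with $M'$ simple, or (c) $M$ reduces by weak head reduction, contracting only simple redexes, to $y M_1\cdots M_m$ with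 $y$ a variable, $m\ge 0$ and $M_1,\dots,M_m$ simple. \textbf{Theorem.} Let $M$ and $N$ be simple $\lambda$-terms. Then $\mathsf{cLL}(M)$ and $\mathsf{cLL}(N)$ are well defined (each of $M$ and $N$ has exactly one infinitary normal form), and if $M$ and $N$ do not eventually match, that is, $\mathsf{cLL}(M) \neq_\tau \mathsf{cLL}(N)$, then $M$ and $N$ are not $\beta$-convertible. -/

import Mathlib

namespace ClockedLambda

/-! ### Finite λ-terms and β-reduction -/

/-- The (finite, pure) λ-terms modulo α-equivalence, in de Bruijn representation. An index that
points beyond all enclosing binders is a free variable. -/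
inductive LTerm : Type where
  | var : ℕ → LTerm
  | app : LTerm → LTerm → LTerm
  | lam : LTerm → LTerm

namespace LTerm

/-- The lifting of a renaming under a binder. -/
def upRen (ρ : ℕ → ℕ) : ℕ → ℕ
  | 0 => 0
  | n + 1 => ρ n + 1

def rename : (ℕ → ℕ) → LTerm → LTerm
  | ρ, var n => var (ρ n)
  | ρ, app M N => app (rename ρ M) (rename ρ N)
  | ρ, lam M => lam (rename (upRen ρ) M)

/-- The lifting of a substitution under a binder. -/
def up (σ : ℕ → LTerm) : ℕ → LTerm
  | 0 => var 0
  | n + 1 => rename Nat.succ (σ n)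

/-- Simultaneous capture-avoiding substitution. -/
def subst : (ℕ → LTerm) → LTerm → LTerm
  | σ, var n => σ n
  | σ, app M N => app (subst σ M) (subst σ N)
  | σ, lam M => lam (subst (up σ) M)

/-- The substitution that replaces the variable with index `0` by `N` and lowers the others. -/
def single (N : LTerm) : ℕ → LTerm
  | 0 => N
  | n + 1 => var n

/-- `inst M N` is `M[x := N]`, where `x` is the variable bound by the λ in `lam M`. -/
def inst (M N : LTerm) : LTerm := subst (single N) M

/-- One step of β-reduction, in any context. -/
inductive Beta : LTerm → LTerm → Prop
  | beta (M N : LTerm) : Beta (app (lam M) N) (inst M N)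
  | appL {M M' : LTerm} (N : LTerm) : Beta M M' → Beta (app M N) (app M' N)
  | appR (M : LTerm) {N N' : LTerm} : Beta N N' → Beta (app M N) (app M N')
  | lam {M M' : LTerm} : Beta M M' → Beta (lam M) (lam M')

/-- β-convertibility: the equivalence closure of β-reduction. -/
def BetaConv : LTerm → LTerm → Prop := Relation.EqvGen Beta

/-- β-normal forms. -/
def IsNormal (M : LTerm) : Prop := ∀ N, ¬ Beta M N

/-- `apps M [M₁, …, Mₘ]` is `M M₁ … Mₘ`. -/
def apps (M : LTerm) (Ms : List LTerm) : LTerm := Ms.foldl app M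

/-- Weak head normal forms: `λx.M` or `y M₁ … Mₘ`. -/
def IsWhnf (M : LTerm) : Prop :=
  (∃ M', M = lam M') ∨ ∃ (y : ℕ) (Ms : List LTerm), M = apps (var y) Ms

def HasWhnf (M : LTerm) : Prop := ∃ W, Relation.ReflTransGen Beta M W ∧ IsWhnf W

/-- The number of free occurrences of the variable with index `k`. -/
def occ : ℕ → LTerm → ℕ
  | k, var n => if n = k then 1 else 0
  | k, app M N => occ k M + occ k N
  | k, lam M => occ (k + 1) M

/-- The redex `(λx.M) N` is linear: `x` has at most one occurrence in `M`. -/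
def LinearRedex (M _N : LTerm) : Prop := occ 0 M ≤ 1

/-- The redex `(λx.M) N` is call-by-value: `N` is a normal form. -/
def CallByValueRedex (_M N : LTerm) : Prop := IsNormal N

/-- The redex `(λx.M) N` is simple. -/
def SimpleRedex (M N : LTerm) : Prop := LinearRedex M N ∨ CallByValueRedex M N

/-- One step of (weak) head reduction `(λx.M) N R₁ … Rₘ → M[x := N] R₁ … Rₘ` that contracts a
simple redex `(λx.M) N`. -/
inductive SimpleHead : LTerm → LTerm → Prop
  | beta (M N : LTerm) : SimpleRedex M N → SimpleHead (app (lam M) N) (inst M N)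
  | appL {M M' : LTerm} (R : LTerm) : SimpleHead M M' → SimpleHead (app M R) (app M' R)

/-- The clauses of the definition of simple terms, relative to a set `S` of terms. -/
def SimpleClauses (S : LTerm → Prop) (M : LTerm) : Prop :=
  ¬ HasWhnf M ∨
  (∃ M', Relation.ReflTransGen SimpleHead M (lam M') ∧ S M') ∨
  (∃ (y : ℕ) (Ms : List LTerm), Relation.ReflTransGen SimpleHead M (apps (var y) Ms) ∧
    ∀ M' ∈ Ms, S M')

/-- Simple terms: the largest set of terms that is closed under the clauses (the definition is
coinductive). -/
def Simple (M : LTerm) : Prop :=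
  ∃ S : LTerm → Prop, S M ∧ ∀ M', S M' → SimpleClauses S M'

end LTerm

/-! ### Finite and infinite terms of the clocked λ-calculus -/

/-- The symbols of the clocked λ-calculus. -/
inductive Shape : Type where
  | var : ℕ → Shape
  | app : Shape
  | lam : Shape
  | tau : Shape

/-- The argument positions of the symbols; for `app`, `true` is the function and `false` is the
argument. -/
abbrev Shape.Pos : Shape → Type
  | var _ => Empty
  | app => Bool
  | lam => Unit
  | tau => Unit

abbrev sig : PFunctor.{0, 0} := ⟨Shape, Shape.Pos⟩

/-- The finite and infinite terms over variables, application, abstraction and the unary symbol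
`τ`, modulo α-equivalence, in de Bruijn representation. -/
def CTerm : Type := PFunctor.M sig

namespace CTerm

/-- The root symbol of a term, with its immediate subterms. -/
def dest (M : CTerm) : sig CTerm := PFunctor.M.dest M

def var (n : ℕ) : CTerm := PFunctor.M.mk (F := sig) ⟨Shape.var n, Empty.elim⟩
def app (M N : CTerm) : CTerm := PFunctor.M.mk (F := sig) ⟨Shape.app, fun b : Bool => cond b M N⟩
def lam (M : CTerm) : CTerm := PFunctor.M.mk (F := sig) ⟨Shape.lam, fun _ => M⟩
def tau (M : CTerm) : CTerm := PFunctor.M.mk (F := sig) ⟨Shape.tau, fun _ => M⟩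

instance : Nonempty CTerm := ⟨var 0⟩

def renameStep : (ℕ → ℕ) × CTerm → sig ((ℕ → ℕ) × CTerm)
  | (ρ, M) =>
    match M.dest with
    | ⟨Shape.var n, _⟩ => ⟨Shape.var (ρ n), Empty.elim⟩
    | ⟨Shape.app, c⟩ => ⟨Shape.app, fun i => (ρ, c i)⟩
    | ⟨Shape.lam, c⟩ => ⟨Shape.lam, fun i => (LTerm.upRen ρ, c i)⟩
    | ⟨Shape.tau, c⟩ => ⟨Shape.tau, fun i => (ρ, c i)⟩

/-- Renaming, by corecursion. -/
def rename (ρ : ℕ → ℕ) (M : CTerm) : CTerm := PFunctor.M.corec renameStep (ρ, M)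

/-- The lifting of a substitution under a binder. -/
def up (σ : ℕ → CTerm) : ℕ → CTerm
  | 0 => var 0
  | n + 1 => rename Nat.succ (σ n)

/-- A state `inl (σ, M)` stands for `M` under the substitution `σ`; a state `inr M` stands for `M`
itself. -/
def substStep : ((ℕ → CTerm) × CTerm) ⊕ CTerm → sig (((ℕ → CTerm) × CTerm) ⊕ CTerm)
  | Sum.inr M => sig.map Sum.inr M.dest
  | Sum.inl (σ, M) =>
    match M.dest with
    | ⟨Shape.var n, _⟩ => sig.map Sum.inr (σ n).dest
    | ⟨Shape.app, c⟩ => ⟨Shape.app, fun i => Sum.inl (σ, c i)⟩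
    | ⟨Shape.lam, c⟩ => ⟨Shape.lam, fun i => Sum.inl (up σ, c i)⟩
    | ⟨Shape.tau, c⟩ => ⟨Shape.tau, fun i => Sum.inl (σ, c i)⟩

/-- Simultaneous capture-avoiding substitution, by corecursion. -/
def subst (σ : ℕ → CTerm) (M : CTerm) : CTerm := PFunctor.M.corec substStep (Sum.inl (σ, M))

/-- The substitution that replaces the variable with index `0` by `N` and lowers the others. -/
def single (N : CTerm) : ℕ → CTerm
  | 0 => N
  | n + 1 => var n

/-- `inst M N` is `M[x := N]`, where `x` is the variable bound by the λ in `lam M`. -/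
def inst (M N : CTerm) : CTerm := subst (single N) M

/-- One step of the clocked λ-calculus: the rules `(λx.M) N → τ(M[x := N])` and
`τ(M) N → τ(M N)`, in any context. -/
inductive Step : CTerm → CTerm → Prop
  | beta (M N : CTerm) : Step (app (lam M) N) (tau (inst M N))
  | shift (M N : CTerm) : Step (app (tau M) N) (tau (app M N))
  | appL {M M' : CTerm} (N : CTerm) : Step M M' → Step (app M N) (app M' N)
  | appR (M : CTerm) {N N' : CTerm} : Step N N' → Step (app M N) (app M N')
  | lam {M M' : CTerm} : Step M M' → Step (lam M) (lam M')
  | tau {M M' : CTerm} : Step M M' → Step (tau M) (tau M')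

/-- Normal forms of the clocked λ-calculus. -/
def IsNormal (M : CTerm) : Prop := ∀ N, ¬ Step M N

/-- The clauses of infinitary reduction, relative to a relation `R`: finitely many steps produce
the root symbol of the target, and `R` relates the immediate subterms. -/
def InfRedClauses (R : CTerm → CTerm → Prop) (M N : CTerm) : Prop :=
  (∃ n, Relation.ReflTransGen Step M (var n) ∧ N = var n) ∨
  (∃ P Q P' Q', Relation.ReflTransGen Step M (app P Q) ∧ N = app P' Q' ∧ R P P' ∧ R Q Q') ∨
  (∃ P P', Relation.ReflTransGen Step M (lam P) ∧ N = lam P' ∧ R P P') ∨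
  (∃ P P', Relation.ReflTransGen Step M (tau P) ∧ N = tau P' ∧ R P P')

/-- Infinitary (strongly convergent) reduction of the clocked λ-calculus, defined coinductively as
the largest relation that is closed under the clauses. -/
def InfRed (M N : CTerm) : Prop :=
  ∃ R : CTerm → CTerm → Prop, R M N ∧ ∀ M' N', R M' N' → InfRedClauses R M' N'

/-- `T` is an infinitary normal form of `M`. -/
def IsInfNormalFormOf (T M : CTerm) : Prop := InfRed M T ∧ IsNormal T

/-- The clocked Lévy tree of `M`: the infinitary normal form of `M`. -/
noncomputable def clockedLevyTree (M : CTerm) : CTerm :=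
  Classical.epsilon fun T => IsInfNormalFormOf T M

/-- One step of the rule `τ(M) → M`, in any context. -/
inductive TauStep : CTerm → CTerm → Prop
  | drop (M : CTerm) : TauStep (tau M) M
  | appL {M M' : CTerm} (N : CTerm) : TauStep M M' → TauStep (app M N) (app M' N)
  | appR (M : CTerm) {N N' : CTerm} : TauStep N N' → TauStep (app M N) (app M N')
  | lam {M M' : CTerm} : TauStep M M' → TauStep (lam M) (lam M')
  | tau {M M' : CTerm} : TauStep M M' → TauStep (tau M) (tau M')

/-- The equivalence closure `=_τ`. -/
def TauEq : CTerm → CTerm → Prop := Relation.EqvGen TauStep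

/-- `M` eventually matches `N`: their clocked Lévy trees are τ-equivalent. -/
def EventuallyMatches (M N : CTerm) : Prop := TauEq (clockedLevyTree M) (clockedLevyTree N)

end CTerm

/-- The inclusion of the λ-terms in the terms of the clocked λ-calculus. -/
def LTerm.toCTerm : LTerm → CTerm
  | var n => CTerm.var n
  | app M N => CTerm.app M.toCTerm N.toCTerm
  | lam M => CTerm.lam M.toCTerm

end ClockedLambda

/-! Well-definedness. Contracting a weak head redex of a finite clocked term puts a `τ` at the root,
and this `τ` never disappears. So finitely many steps fix the root symbol (`FTerm.whd`), and
corecursion on the subterms gives `FTerm.tree`. Parallel reduction respects the root found by `whd`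
(`FTerm.Par.whd`), so the tree is invariant under clocked reduction. A bisimulation then identifies
it with every infinitary normal form (`FTerm.isInfNormalFormOf_iff`).

Invariance. By Church–Rosser, two convertible terms have a common reduct, so it suffices that a
simple `M` and any reduct `L` of `M` have τ-equivalent trees (`LTerm.Simple.tauEq_tree`). Simplicity
keeps the reduction from growing: a simple redex duplicates no step inside its argument. If `M`
reduces to `L` in at most `n` steps and a simple head step leads from `M` to `M₁`, then either `M₁`
reaches `L` in fewer than `n` steps, or `L` makes a head step too and the bound `n` survives
(`LTerm.SimpleHead.project`). In the first case the trees differ by one more `τ`, but the bound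
drops; in the second, both trees start with `τ`. At an application the bound is divided between the
two sides. Hence only finitely many `τ`'s differ in the whole tree. Terms without weak head normal
form all have the same tree, an infinite tower of `τ`'s. -/

namespace ClockedLambda

/-! ### Constructors, bisimulation and substitution for infinite terms. -/

namespace CTerm

@[simp] theorem dest_var (n : ℕ) : (var n).dest = ⟨Shape.var n, Empty.elim⟩ := rfl
@[simp] theorem dest_app (M N : CTerm) :
    (app M N).dest = ⟨Shape.app, fun b : Bool => cond b M N⟩ := rfl
@[simp] theorem dest_lam (M : CTerm) : (lam M).dest = ⟨Shape.lam, fun _ => M⟩ := rfl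
@[simp] theorem dest_tau (M : CTerm) : (tau M).dest = ⟨Shape.tau, fun _ => M⟩ := rfl

@[simp] theorem var_inj {m n : ℕ} : var m = var n ↔ m = n := by
  refine ⟨fun h => ?_, fun h => h ▸ rfl⟩
  have := congrArg (fun M => M.dest.1) h
  simpa using this

theorem children_eq {s : Shape} {c c' : s.Pos → CTerm}
    (h : (⟨s, c⟩ : sig CTerm) = ⟨s, c'⟩) : c = c' := by
  cases h
  rfl

@[simp] theorem app_inj {M N M' N' : CTerm} : app M N = app M' N' ↔ M = M' ∧ N = N' := by
  refine ⟨fun h => ?_, fun h => by rw [h.1, h.2]⟩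
  have h := children_eq (s := Shape.app) (c := fun b : Bool => cond b M N)
    (c' := fun b : Bool => cond b M' N') (congrArg dest h)
  exact ⟨congrFun h true, congrFun h false⟩

@[simp] theorem lam_inj {M M' : CTerm} : lam M = lam M' ↔ M = M' := by
  refine ⟨fun h => ?_, fun h => h ▸ rfl⟩
  have h := children_eq (s := Shape.lam) (c := fun _ => M) (c' := fun _ => M')
    (congrArg dest h)
  exact congrFun h ()

@[simp] theorem tau_inj {M M' : CTerm} : tau M = tau M' ↔ M = M' := by
  refine ⟨fun h => ?_, fun h => h ▸ rfl⟩
  have h := children_eq (s := Shape.tau) (c := fun _ => M) (c' := fun _ => M')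
    (congrArg dest h)
  exact congrFun h ()

theorem ne_of_root_ne {M N : CTerm} (h : M.dest.1 ≠ N.dest.1) : M ≠ N := fun e => h (e ▸ rfl)

@[simp] theorem var_ne_app {n : ℕ} {M N : CTerm} : var n ≠ app M N := ne_of_root_ne (by simp)
@[simp] theorem var_ne_lam {n : ℕ} {M : CTerm} : var n ≠ lam M := ne_of_root_ne (by simp)
@[simp] theorem var_ne_tau {n : ℕ} {M : CTerm} : var n ≠ tau M := ne_of_root_ne (by simp)
@[simp] theorem app_ne_var {n : ℕ} {M N : CTerm} : app M N ≠ var n := ne_of_root_ne (by simp)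
@[simp] theorem app_ne_lam {M N P : CTerm} : app M N ≠ lam P := ne_of_root_ne (by simp)
@[simp] theorem app_ne_tau {M N P : CTerm} : app M N ≠ tau P := ne_of_root_ne (by simp)
@[simp] theorem lam_ne_var {n : ℕ} {M : CTerm} : lam M ≠ var n := ne_of_root_ne (by simp)
@[simp] theorem lam_ne_app {M N P : CTerm} : lam P ≠ app M N := ne_of_root_ne (by simp)
@[simp] theorem lam_ne_tau {M N : CTerm} : lam M ≠ tau N := ne_of_root_ne (by simp)
@[simp] theorem tau_ne_var {n : ℕ} {M : CTerm} : tau M ≠ var n := ne_of_root_ne (by simp)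
@[simp] theorem tau_ne_app {M N P : CTerm} : tau P ≠ app M N := ne_of_root_ne (by simp)
@[simp] theorem tau_ne_lam {M N : CTerm} : tau M ≠ lam N := ne_of_root_ne (by simp)

/-- Two terms have the same root symbol and `R`-related immediate subterms. -/
inductive SameRoot (R : CTerm → CTerm → Prop) : CTerm → CTerm → Prop
  | var (n : ℕ) : SameRoot R (var n) (var n)
  | app {M N M' N' : CTerm} : R M M' → R N N' → SameRoot R (app M N) (app M' N')
  | lam {M M' : CTerm} : R M M' → SameRoot R (lam M) (lam M')
  | tau {M M' : CTerm} : R M M' → SameRoot R (tau M) (tau M')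

theorem SameRoot.refl {R : CTerm → CTerm → Prop} (h : ∀ M, R M M) (M : CTerm) :
    SameRoot R M M := by
  rw [← PFunctor.M.mk_dest M]
  rcases hM : PFunctor.M.dest M with ⟨s, c⟩
  cases s with
  | var n => rw [show c = Empty.elim from funext fun i => i.elim]; exact .var n
  | app =>
    rw [show c = fun b : Bool => cond b (c true) (c false) by funext b; cases b <;> rfl]
    exact .app (h _) (h _)
  | lam => exact .lam (h (c ()))
  | tau => exact .tau (h (c ()))

theorem eq_of_bisim (R : CTerm → CTerm → Prop) (h : ∀ M N, R M N → SameRoot R M N)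
    {M N : CTerm} (hMN : R M N) : M = N := by
  refine PFunctor.M.bisim (P := sig) R (fun x y hxy => ?_) M N hMN
  cases h x y hxy with
  | var n => exact ⟨_, _, _, dest_var n, dest_var n, fun i => i.elim⟩
  | app h₁ h₂ =>
    refine ⟨_, _, _, dest_app _ _, dest_app _ _, fun i => ?_⟩
    cases i
    · exact h₂
    · exact h₁
  | lam h₁ => exact ⟨_, _, _, dest_lam _, dest_lam _, fun _ => h₁⟩
  | tau h₁ => exact ⟨_, _, _, dest_tau _, dest_tau _, fun _ => h₁⟩

theorem mk_app (c : Bool → CTerm) :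
    PFunctor.M.mk (F := sig) ⟨Shape.app, c⟩ = app (c true) (c false) := by
  unfold app
  congr 2
  funext b
  cases b <;> rfl

theorem mk_var (n : ℕ) (c : Empty → CTerm) :
    PFunctor.M.mk (F := sig) ⟨Shape.var n, c⟩ = var n := by
  unfold var
  congr 2
  funext b
  cases b

@[simp] theorem rename_var (ρ : ℕ → ℕ) (n : ℕ) : rename ρ (var n) = var (ρ n) := by
  unfold rename
  rw [PFunctor.M.corec_def]
  exact mk_var _ _

@[simp] theorem rename_app (ρ : ℕ → ℕ) (M N : CTerm) :
    rename ρ (app M N) = app (rename ρ M) (rename ρ N) := by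
  unfold rename
  rw [PFunctor.M.corec_def]
  exact mk_app _

@[simp] theorem rename_lam (ρ : ℕ → ℕ) (M : CTerm) :
    rename ρ (lam M) = lam (rename (LTerm.upRen ρ) M) := by
  unfold rename
  rw [PFunctor.M.corec_def]
  rfl

@[simp] theorem rename_tau (ρ : ℕ → ℕ) (M : CTerm) : rename ρ (tau M) = tau (rename ρ M) := by
  unfold rename
  rw [PFunctor.M.corec_def]
  rfl

/-- An `inr` state only copies its term, so the graph of the corecursion is a bisimulation. -/
theorem corec_substStep_inr (M : CTerm) : PFunctor.M.corec substStep (Sum.inr M) = M := by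
  refine PFunctor.M.bisim (P := sig)
    (fun x y => x = PFunctor.M.corec substStep (Sum.inr y)) (fun x y hxy => ?_) _ _ rfl
  subst hxy
  exact ⟨_, _, _, PFunctor.M.dest_corec _ _, rfl, fun _ => rfl⟩

@[simp] theorem subst_var (σ : ℕ → CTerm) (n : ℕ) : subst σ (var n) = σ n := by
  unfold subst
  rw [PFunctor.M.corec_def, ← PFunctor.M.mk_dest (σ n)]
  change PFunctor.M.mk (F := sig) ⟨(σ n).dest.1,
    fun i => PFunctor.M.corec substStep (Sum.inr ((σ n).dest.2 i))⟩ = _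
  simp only [corec_substStep_inr]
  rfl

@[simp] theorem subst_app (σ : ℕ → CTerm) (M N : CTerm) :
    subst σ (app M N) = app (subst σ M) (subst σ N) := by
  unfold subst
  rw [PFunctor.M.corec_def]
  exact mk_app _

@[simp] theorem subst_lam (σ : ℕ → CTerm) (M : CTerm) :
    subst σ (lam M) = lam (subst (up σ) M) := by
  unfold subst
  rw [PFunctor.M.corec_def]
  rfl

@[simp] theorem subst_tau (σ : ℕ → CTerm) (M : CTerm) : subst σ (tau M) = tau (subst σ M) := by
  unfold subst
  rw [PFunctor.M.corec_def]
  rfl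

end CTerm

/-! ### Finite clocked terms and their substitution calculus. -/

/-- The finite terms of the clocked λ-calculus. -/
inductive FTerm : Type where
  | var : ℕ → FTerm
  | app : FTerm → FTerm → FTerm
  | lam : FTerm → FTerm
  | tau : FTerm → FTerm

namespace FTerm

open LTerm (upRen)

def rename : (ℕ → ℕ) → FTerm → FTerm
  | ρ, var n => var (ρ n)
  | ρ, app a b => app (rename ρ a) (rename ρ b)
  | ρ, lam a => lam (rename (upRen ρ) a)
  | ρ, tau a => tau (rename ρ a)

def up (σ : ℕ → FTerm) : ℕ → FTerm
  | 0 => var 0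
  | n + 1 => rename Nat.succ (σ n)

def subst : (ℕ → FTerm) → FTerm → FTerm
  | σ, var n => σ n
  | σ, app a b => app (subst σ a) (subst σ b)
  | σ, lam a => lam (subst (up σ) a)
  | σ, tau a => tau (subst σ a)

def single (b : FTerm) : ℕ → FTerm
  | 0 => b
  | n + 1 => var n

def inst (a b : FTerm) : FTerm := subst (single b) a

theorem upRen_comp (ξ ρ : ℕ → ℕ) : upRen (ξ ∘ ρ) = upRen ξ ∘ upRen ρ := by
  funext n; cases n <;> rfl

theorem rename_rename (ξ ρ : ℕ → ℕ) (a : FTerm) : rename ξ (rename ρ a) = rename (ξ ∘ ρ) a := by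
  induction a generalizing ξ ρ with
  | var n => rfl
  | app a b iha ihb => simp [rename, iha, ihb]
  | lam a ih => simp [rename, ih, upRen_comp]
  | tau a ih => simp [rename, ih]

theorem up_comp_upRen (σ : ℕ → FTerm) (ρ : ℕ → ℕ) : up (σ ∘ ρ) = up σ ∘ upRen ρ := by
  funext n; cases n <;> rfl

theorem subst_rename (σ : ℕ → FTerm) (ρ : ℕ → ℕ) (a : FTerm) :
    subst σ (rename ρ a) = subst (σ ∘ ρ) a := by
  induction a generalizing σ ρ with
  | var n => rfl
  | app a b iha ihb => simp [rename, subst, iha, ihb]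
  | lam a ih => simp [rename, subst, ih, up_comp_upRen]
  | tau a ih => simp [rename, subst, ih]

theorem up_rename_comp (ξ : ℕ → ℕ) (σ : ℕ → FTerm) :
    up (rename ξ ∘ σ) = rename (upRen ξ) ∘ up σ := by
  funext n
  cases n with
  | zero => rfl
  | succ n => simp only [up, Function.comp, rename_rename]; rfl

theorem rename_subst (ξ : ℕ → ℕ) (σ : ℕ → FTerm) (a : FTerm) :
    rename ξ (subst σ a) = subst (rename ξ ∘ σ) a := by
  induction a generalizing σ ξ with
  | var n => rfl
  | app a b iha ihb => simp [rename, subst, iha, ihb]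
  | lam a ih => simp [rename, subst, ih, up_rename_comp]
  | tau a ih => simp [rename, subst, ih]

theorem up_subst_comp (θ σ : ℕ → FTerm) : up (subst θ ∘ σ) = subst (up θ) ∘ up σ := by
  funext n
  cases n with
  | zero => rfl
  | succ n => simp only [up, Function.comp, rename_subst, subst_rename]; rfl

/-- The composition laws come in this order because passing a binder in one of them uses the earlier
ones, where renamings replace one or both of the substitutions. -/
theorem subst_subst (θ σ : ℕ → FTerm) (a : FTerm) :
    subst θ (subst σ a) = subst (subst θ ∘ σ) a := by
  induction a generalizing σ θ with
  | var n => rfl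
  | app a b iha ihb => simp [subst, iha, ihb]
  | lam a ih => simp [subst, ih, up_subst_comp]
  | tau a ih => simp [subst, ih]

theorem up_var : up var = var := by funext n; cases n <;> rfl

theorem subst_var (a : FTerm) : subst var a = a := by
  induction a with
  | var n => rfl
  | app a b iha ihb => simp [subst, iha, ihb]
  | lam a ih => simp [subst, ih, up_var]
  | tau a ih => simp [subst, ih]

theorem rename_inst (ρ : ℕ → ℕ) (a b : FTerm) :
    rename ρ (inst a b) = inst (rename (upRen ρ) a) (rename ρ b) := by
  unfold inst
  rw [rename_subst, subst_rename]
  congr 1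
  funext n
  cases n <;> rfl

theorem subst_inst (σ : ℕ → FTerm) (a b : FTerm) :
    subst σ (inst a b) = inst (subst (up σ) a) (subst σ b) := by
  unfold inst
  rw [subst_subst, subst_subst]
  congr 1
  funext n
  cases n with
  | zero => rfl
  | succ n =>
    simp only [Function.comp, up, single, subst_rename, subst]
    exact (subst_var _).symm

/-- The inclusion of the finite terms in the finite and infinite terms. -/
def toCTerm : FTerm → CTerm
  | var n => CTerm.var n
  | app a b => CTerm.app a.toCTerm b.toCTerm
  | lam a => CTerm.lam a.toCTerm
  | tau a => CTerm.tau a.toCTerm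

theorem toCTerm_rename (ρ : ℕ → ℕ) (a : FTerm) :
    (rename ρ a).toCTerm = CTerm.rename ρ a.toCTerm := by
  induction a generalizing ρ with
  | var n => simp [rename, toCTerm]
  | app a b iha ihb => simp [rename, toCTerm, iha, ihb]
  | lam a ih => simp [rename, toCTerm, ih]
  | tau a ih => simp [rename, toCTerm, ih]

theorem toCTerm_up (σ : ℕ → FTerm) :
    (fun n => (up σ n).toCTerm) = CTerm.up (fun n => (σ n).toCTerm) := by
  funext n
  cases n with
  | zero => rfl
  | succ n => exact toCTerm_rename _ _

theorem toCTerm_subst (σ : ℕ → FTerm) (a : FTerm) :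
    (subst σ a).toCTerm = CTerm.subst (fun n => (σ n).toCTerm) a.toCTerm := by
  induction a generalizing σ with
  | var n => simp [subst, toCTerm]
  | app a b iha ihb => simp [subst, toCTerm, iha, ihb]
  | lam a ih => simp [subst, toCTerm, ih, toCTerm_up]
  | tau a ih => simp [subst, toCTerm, ih]

theorem toCTerm_inst (a b : FTerm) :
    (inst a b).toCTerm = CTerm.inst a.toCTerm b.toCTerm := by
  unfold inst CTerm.inst
  rw [toCTerm_subst]
  congr 1
  funext n
  cases n <;> rfl

/-! ### Parallel reduction of finite clocked terms. -/

/-- Parallel reduction of the clocked λ-calculus on finite terms. -/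
inductive Par : FTerm → FTerm → Prop
  | var (n : ℕ) : Par (var n) (var n)
  | app {a a' b b' : FTerm} : Par a a' → Par b b' → Par (app a b) (app a' b')
  | lam {a a' : FTerm} : Par a a' → Par (lam a) (lam a')
  | tau {a a' : FTerm} : Par a a' → Par (tau a) (tau a')
  | beta {a a' b b' : FTerm} : Par a a' → Par b b' → Par (app (lam a) b) (tau (inst a' b'))
  | shift {a a' b b' : FTerm} : Par a a' → Par b b' → Par (app (tau a) b) (tau (app a' b'))

theorem Par.refl (a : FTerm) : Par a a := by
  induction a with
  | var n => exact .var n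
  | app a b iha ihb => exact .app iha ihb
  | lam a ih => exact .lam ih
  | tau a ih => exact .tau ih

theorem Par.rename {a a' : FTerm} (h : Par a a') (ρ : ℕ → ℕ) :
    Par (rename ρ a) (rename ρ a') := by
  induction h generalizing ρ with
  | var n => exact .var _
  | app _ _ ih₁ ih₂ => exact .app (ih₁ ρ) (ih₂ ρ)
  | lam _ ih => exact .lam (ih _)
  | tau _ ih => exact .tau (ih ρ)
  | beta _ _ ih₁ ih₂ =>
    simp only [FTerm.rename, rename_inst]
    exact .beta (ih₁ _) (ih₂ ρ)
  | shift _ _ ih₁ ih₂ => exact .shift (ih₁ ρ) (ih₂ ρ)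

theorem Par.up {σ σ' : ℕ → FTerm} (h : ∀ n, Par (σ n) (σ' n)) (n : ℕ) :
    Par (up σ n) (up σ' n) := by
  cases n with
  | zero => exact .var 0
  | succ n => exact (h n).rename _

theorem Par.subst {a a' : FTerm} (h : Par a a') {σ σ' : ℕ → FTerm} (hσ : ∀ n, Par (σ n) (σ' n)) :
    Par (subst σ a) (subst σ' a') := by
  induction h generalizing σ σ' with
  | var n => exact hσ n
  | app _ _ ih₁ ih₂ => exact .app (ih₁ hσ) (ih₂ hσ)
  | lam _ ih => exact .lam (ih (Par.up hσ))
  | tau _ ih => exact .tau (ih hσ)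
  | beta _ _ ih₁ ih₂ =>
    simp only [FTerm.subst, subst_inst]
    exact .beta (ih₁ (Par.up hσ)) (ih₂ hσ)
  | shift _ _ ih₁ ih₂ => exact .shift (ih₁ hσ) (ih₂ hσ)

theorem Par.inst {a a' b b' : FTerm} (ha : Par a a') (hb : Par b b') :
    Par (inst a b) (inst a' b') :=
  ha.subst fun n => by
    cases n with
    | zero => exact hb
    | succ n => exact .var n

/-- Steps from finite terms lead to finite terms, so finitary reduction can be studied in the
inductive type. -/
theorem exists_par_of_step {A B : CTerm} (h : CTerm.Step A B) {a : FTerm} (ha : a.toCTerm = A) :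
    ∃ b : FTerm, b.toCTerm = B ∧ Par a b := by
  induction h generalizing a with
  | beta M N =>
    cases a <;> simp [toCTerm] at ha
    rename_i f b
    obtain ⟨hf, rfl⟩ := ha
    cases f <;> simp [toCTerm] at hf
    subst hf
    exact ⟨_, by simp [toCTerm, toCTerm_inst], .beta (.refl _) (.refl _)⟩
  | shift M N =>
    cases a <;> simp [toCTerm] at ha
    rename_i f b
    obtain ⟨hf, rfl⟩ := ha
    cases f <;> simp [toCTerm] at hf
    subst hf
    exact ⟨_, by simp [toCTerm], .shift (.refl _) (.refl _)⟩
  | appL N _ ih =>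
    cases a <;> simp [toCTerm] at ha
    obtain ⟨b, rfl, hb⟩ := ih ha.1
    exact ⟨.app b _, by rw [toCTerm, ha.2], .app hb (.refl _)⟩
  | appR M _ ih =>
    cases a <;> simp [toCTerm] at ha
    obtain ⟨b, rfl, hb⟩ := ih ha.2
    exact ⟨.app _ b, by rw [toCTerm, ha.1], .app (.refl _) hb⟩
  | lam _ ih =>
    cases a <;> simp [toCTerm] at ha
    obtain ⟨b, rfl, hb⟩ := ih ha
    exact ⟨.lam b, rfl, .lam hb⟩
  | tau _ ih =>
    cases a <;> simp [toCTerm] at ha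
    obtain ⟨b, rfl, hb⟩ := ih ha
    exact ⟨.tau b, rfl, .tau hb⟩

/-! ### Root-stable reducts and the tree of a finite term. -/

/-- The root-stable reduct of a finite term: `τ M₁` if the weak head redex of the term contracts
to `M₁`, and the term itself if it has no weak head redex. -/
def whd : FTerm → FTerm
  | var n => var n
  | lam a => lam a
  | tau a => tau a
  | app a b =>
    match whd a with
    | lam c => tau (inst c b)
    | tau c => tau (app c b)
    | var _ => app a b
    | app _ _ => app a b

/-- The congruence cases of parallel reduction. -/
inductive RootPar : FTerm → FTerm → Prop
  | var (n : ℕ) : RootPar (var n) (var n)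
  | app {a a' b b' : FTerm} : Par a a' → Par b b' → RootPar (app a b) (app a' b')
  | lam {a a' : FTerm} : Par a a' → RootPar (lam a) (lam a')
  | tau {a a' : FTerm} : Par a a' → RootPar (tau a) (tau a')

/-- Both rules put a `τ` at the root, which is where `whd` stops as well; so a contracted weak head
redex and its residual yield the same root. In the application case the roots of the two function
parts agree by induction, so both sides take the same branch of `whd`. -/
theorem Par.whd {a b : FTerm} (h : Par a b) : RootPar (whd a) (whd b) := by
  induction h with
  | var n => exact .var n
  | lam h _ => exact .lam h
  | tau h _ => exact .tau h
  | beta ha hb _ _ => exact .tau (ha.inst hb)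
  | shift ha hb _ _ => exact .tau (.app ha hb)
  | @app a a' b b' ha hb iha _ =>
    simp only [FTerm.whd]
    revert iha
    generalize a.whd = w
    generalize a'.whd = w'
    intro iha
    cases iha with
    | var n => exact .app ha hb
    | app _ _ => exact .app ha hb
    | lam h => exact .tau (h.inst hb)
    | tau h => exact .tau (.app h hb)

theorem step_whd (a : FTerm) : Relation.ReflTransGen CTerm.Step a.toCTerm a.whd.toCTerm := by
  induction a with
  | var n => exact .refl
  | lam a _ => exact .refl
  | tau a _ => exact .refl
  | app a b iha _ =>
    have h := Relation.ReflTransGen.lift (p := CTerm.Step) (fun A => CTerm.app A b.toCTerm)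
      (fun _ _ h => CTerm.Step.appL _ h) _ _ iha
    simp only [whd]
    cases hw : a.whd with
    | var _ => exact .refl
    | app _ _ => exact .refl
    | lam c =>
      rw [hw] at h
      simp only [toCTerm] at h ⊢
      rw [toCTerm_inst]
      exact h.tail (.beta _ _)
    | tau c =>
      rw [hw] at h
      simp only [toCTerm] at h ⊢
      exact h.tail (.shift _ _)

def treeStep (a : FTerm) : sig FTerm :=
  match whd a with
  | var n => ⟨Shape.var n, Empty.elim⟩
  | app b c => ⟨Shape.app, fun i : Bool => cond i b c⟩
  | lam b => ⟨Shape.lam, fun _ => b⟩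
  | tau b => ⟨Shape.tau, fun _ => b⟩

/-- The clocked Lévy tree of a finite term, by corecursion. -/
def tree (a : FTerm) : CTerm := PFunctor.M.corec treeStep a

/-- The tree of a root-stable term. -/
def rootTree : FTerm → CTerm
  | var n => .var n
  | app b c => .app b.tree c.tree
  | lam b => .lam b.tree
  | tau b => .tau b.tree

theorem tree_eq (a : FTerm) : a.tree = a.whd.rootTree := by
  unfold tree
  rw [PFunctor.M.corec_def]
  unfold treeStep
  cases a.whd with
  | var n => exact CTerm.mk_var _ _
  | app b c => exact CTerm.mk_app _
  | lam b => rfl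
  | tau b => rfl

/-- By `Par.whd`, parallel reduction induces a bisimulation on trees. -/
theorem tree_eq_of_par {a b : FTerm} (h : Par a b) : a.tree = b.tree := by
  refine CTerm.eq_of_bisim (fun S T => ∃ a b : FTerm, Par a b ∧ S = a.tree ∧ T = b.tree) ?_
    ⟨a, b, h, rfl, rfl⟩
  rintro _ _ ⟨a, b, h, rfl, rfl⟩
  rw [tree_eq a, tree_eq b]
  have h := h.whd
  revert h
  generalize a.whd = v
  generalize b.whd = w
  intro h
  cases h with
  | var n => exact .var n
  | app h₁ h₂ => exact .app ⟨_, _, h₁, rfl, rfl⟩ ⟨_, _, h₂, rfl, rfl⟩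
  | lam h₁ => exact .lam ⟨_, _, h₁, rfl, rfl⟩
  | tau h₁ => exact .tau ⟨_, _, h₁, rfl, rfl⟩

theorem exists_reduct {a : FTerm} {B : CTerm}
    (h : Relation.ReflTransGen CTerm.Step a.toCTerm B) :
    ∃ b : FTerm, b.toCTerm = B ∧ Relation.ReflTransGen Par a b := by
  induction h with
  | refl => exact ⟨a, rfl, .refl⟩
  | tail _ hs ih =>
    obtain ⟨b, hb, hab⟩ := ih
    obtain ⟨c, hc, hbc⟩ := exists_par_of_step hs hb
    exact ⟨c, hc, hab.tail hbc⟩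

theorem tree_eq_of_reduct {a b : FTerm} (h : Relation.ReflTransGen Par a b) : a.tree = b.tree := by
  induction h with
  | refl => rfl
  | tail _ hs ih => exact ih.trans (tree_eq_of_par hs)

theorem infRed_tree (a : FTerm) : CTerm.InfRed a.toCTerm a.tree := by
  refine ⟨fun S T => ∃ a : FTerm, S = a.toCTerm ∧ T = a.tree, ⟨a, rfl, rfl⟩, ?_⟩
  rintro _ _ ⟨a, rfl, rfl⟩
  have h := step_whd a
  rw [tree_eq a]
  unfold CTerm.InfRedClauses
  cases hw : a.whd with
  | var n => exact .inl ⟨n, by simpa [hw, toCTerm] using h, rfl⟩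
  | app b c =>
    exact .inr (.inl ⟨_, _, _, _, by simpa [hw, toCTerm] using h, rfl, ⟨b, rfl, rfl⟩, ⟨c, rfl, rfl⟩⟩)
  | lam b =>
    exact .inr (.inr (.inl ⟨_, _, by simpa [hw, toCTerm] using h, rfl, ⟨b, rfl, rfl⟩⟩))
  | tau b =>
    exact .inr (.inr (.inr ⟨_, _, by simpa [hw, toCTerm] using h, rfl, ⟨b, rfl, rfl⟩⟩))

/-! ### Existence and uniqueness of the infinitary normal form. -/

/-- The weak head symbol of the term is `λ` or `τ`, below at most `n` applications. -/
inductive Active : ℕ → FTerm → Prop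
  | lam (n : ℕ) (a : FTerm) : Active n (lam a)
  | tau (n : ℕ) (a : FTerm) : Active n (tau a)
  | app {n : ℕ} {a : FTerm} (b : FTerm) : Active n a → Active (n + 1) (app a b)

/-- A contraction on the head spine raises a `τ` towards the root, so the depth bound is kept; it
can then serve as an induction measure although the term changes. -/
theorem Active.par {n : ℕ} {a b : FTerm} (ha : Active n a) (h : Par a b) : Active n b := by
  induction ha generalizing b with
  | lam n a => cases h with | lam _ => exact .lam _ _
  | tau n a => cases h with | tau _ => exact .tau _ _
  | app c _ ih =>
    cases h with
    | app h _ => exact .app _ (ih h)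
    | beta _ _ => exact .tau _ _
    | shift _ _ => exact .tau _ _

theorem Active.reduct {n : ℕ} {a b : FTerm} (ha : Active n a)
    (h : Relation.ReflTransGen Par a b) : Active n b := by
  induction h with
  | refl => exact ha
  | tail _ hs ih => exact ih.par hs

/-- A term without weak head redex is a variable or an application that is not active. -/
theorem active_or_whd_eq (a : FTerm) :
    (∃ n, Active n a) ∨ (∃ n, a = var n) ∨ ∃ b c, a = app b c ∧ a.whd = app b c := by
  induction a with
  | var n => exact .inr (.inl ⟨n, rfl⟩)
  | lam a _ => exact .inl ⟨0, .lam _ _⟩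
  | tau a _ => exact .inl ⟨0, .tau _ _⟩
  | app a b iha _ =>
    rcases iha with ⟨n, h⟩ | ⟨n, rfl⟩ | ⟨c, d, rfl, h⟩
    · exact .inl ⟨_, .app b h⟩
    · exact .inr (.inr ⟨_, _, rfl, rfl⟩)
    · refine .inr (.inr ⟨_, _, rfl, ?_⟩)
      rw [whd, h]

end FTerm

namespace CTerm

theorem InfRed.clauses {M N : CTerm} (h : InfRed M N) : InfRedClauses InfRed M N := by
  obtain ⟨R, hMN, hR⟩ := h
  have lift : ∀ {M N}, R M N → InfRed M N := fun h => ⟨R, h, hR⟩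
  rcases hR _ _ hMN with h | ⟨P, Q, P', Q', h, e, h₁, h₂⟩ | ⟨P, P', h, e, h₁⟩ | ⟨P, P', h, e, h₁⟩
  · exact .inl h
  · exact .inr (.inl ⟨P, Q, P', Q', h, e, lift h₁, lift h₂⟩)
  · exact .inr (.inr (.inl ⟨P, P', h, e, lift h₁⟩))
  · exact .inr (.inr (.inr ⟨P, P', h, e, lift h₁⟩))

theorem IsNormal.appL {M N : CTerm} (h : IsNormal (app M N)) : IsNormal M :=
  fun _ hs => h _ (.appL _ hs)
theorem IsNormal.appR {M N : CTerm} (h : IsNormal (app M N)) : IsNormal N :=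
  fun _ hs => h _ (.appR _ hs)
theorem IsNormal.of_lam {M : CTerm} (h : IsNormal (lam M)) : IsNormal M :=
  fun _ hs => h _ (.lam hs)
theorem IsNormal.of_tau {M : CTerm} (h : IsNormal (tau M)) : IsNormal M :=
  fun _ hs => h _ (.tau hs)

end CTerm

namespace FTerm

/-- If the limit had an application at its root, its function part would come from an active term of
smaller depth and, by induction, start with `λ` or `τ`: a redex in a normal form. -/
theorem Active.infRed {n : ℕ} {a : FTerm} (ha : Active n a) {T : CTerm}
    (h : CTerm.InfRed a.toCTerm T) (hT : T.IsNormal) :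
    (∃ P, T = CTerm.lam P) ∨ ∃ P, T = CTerm.tau P := by
  induction n generalizing a T with
  | zero =>
    rcases h.clauses with ⟨n, hr, rfl⟩ | ⟨P, Q, P', Q', hr, rfl, -, -⟩ | ⟨P, P', hr, rfl, -⟩ |
      ⟨P, P', hr, rfl, -⟩
    · obtain ⟨b, hb, hab⟩ := exists_reduct hr
      cases ha.reduct hab <;> simp [toCTerm] at hb
    · obtain ⟨b, hb, hab⟩ := exists_reduct hr
      cases ha.reduct hab <;> simp [toCTerm] at hb
    · exact .inl ⟨_, rfl⟩
    · exact .inr ⟨_, rfl⟩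
  | succ n ih =>
    rcases h.clauses with ⟨n, hr, rfl⟩ | ⟨P, Q, P', Q', hr, rfl, hP, -⟩ | ⟨P, P', hr, rfl, -⟩ |
      ⟨P, P', hr, rfl, -⟩
    · obtain ⟨b, hb, hab⟩ := exists_reduct hr
      cases ha.reduct hab <;> simp [toCTerm] at hb
    · obtain ⟨b, hb, hab⟩ := exists_reduct hr
      cases ha.reduct hab <;> simp [toCTerm] at hb
      rename_i f e hf
      obtain ⟨rfl, rfl⟩ := hb
      rcases ih hf hP hT.appL with ⟨P, rfl⟩ | ⟨P, rfl⟩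
      · exact (hT _ (.beta _ _)).elim
      · exact (hT _ (.shift _ _)).elim
    · exact .inl ⟨_, rfl⟩
    · exact .inr ⟨_, rfl⟩

/-- The critical case is an application at the root of `T`. The reduct that produced it is not
active, by `Active.infRed` and normality, so `whd` fixes it and the tree has the same root. -/
theorem eq_tree_of_infRed {a : FTerm} {T : CTerm} (h : CTerm.InfRed a.toCTerm T)
    (hT : T.IsNormal) : T = a.tree := by
  refine CTerm.eq_of_bisim
    (fun T S => ∃ a : FTerm, CTerm.InfRed a.toCTerm T ∧ T.IsNormal ∧ S = a.tree) ?_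
    ⟨a, h, hT, rfl⟩
  rintro T _ ⟨a, h, hT, rfl⟩
  rcases h.clauses with ⟨n, hr, rfl⟩ | ⟨P, Q, P', Q', hr, rfl, hP, hQ⟩ | ⟨P, P', hr, rfl, hP⟩ |
    ⟨P, P', hr, rfl, hP⟩
  all_goals
    obtain ⟨b, hb, hab⟩ := exists_reduct hr
    rw [tree_eq_of_reduct hab, tree_eq]
  · cases b <;> simp [toCTerm] at hb
    subst hb
    exact .var _
  · rcases active_or_whd_eq b with ⟨n, hact⟩ | ⟨n, rfl⟩ | ⟨c, d, rfl, hw⟩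
    · cases hact <;> simp [toCTerm] at hb
      rename_i f e hf
      obtain ⟨rfl, rfl⟩ := hb
      rcases hf.infRed hP hT.appL with ⟨P, rfl⟩ | ⟨P, rfl⟩
      · exact (hT _ (.beta _ _)).elim
      · exact (hT _ (.shift _ _)).elim
    · simp [toCTerm] at hb
    · simp [toCTerm] at hb
      obtain ⟨rfl, rfl⟩ := hb
      rw [hw]
      exact .app ⟨c, hP, hT.appL, rfl⟩ ⟨d, hQ, hT.appR, rfl⟩
  · cases b <;> simp [toCTerm] at hb
    subst hb
    exact .lam ⟨_, hP, hT.of_lam, rfl⟩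
  · cases b <;> simp [toCTerm] at hb
    subst hb
    exact .tau ⟨_, hP, hT.of_tau, rfl⟩

theorem whd_ne_of_whd_eq_app {a b c : FTerm} (h : a.whd = app b c) :
    (∃ n, b.whd = var n) ∨ ∃ d e, b.whd = app d e := by
  cases a with
  | var n => simp [whd] at h
  | lam a => simp [whd] at h
  | tau a => simp [whd] at h
  | app a d =>
    simp only [whd] at h
    cases hw : a.whd <;> simp only [hw] at h <;> cases h
    · exact .inl ⟨_, hw⟩
    · exact .inr ⟨_, _, hw⟩

/-- A redex lies at finite depth, so induction on the step moves it to the root of a subtree, where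
`whd_ne_of_whd_eq_app` excludes it. -/
theorem isNormal_tree (a : FTerm) : a.tree.IsNormal := by
  intro N h
  generalize hT : a.tree = T at h
  induction h generalizing a with
  | beta M N =>
    rw [tree_eq] at hT
    cases hw : a.whd <;> simp [hw, rootTree] at hT
    have hT := hT.1
    rw [tree_eq] at hT
    rcases whd_ne_of_whd_eq_app hw with ⟨n, h⟩ | ⟨d, e, h⟩ <;> simp [h, rootTree] at hT
  | shift M N =>
    rw [tree_eq] at hT
    cases hw : a.whd <;> simp [hw, rootTree] at hT
    have hT := hT.1
    rw [tree_eq] at hT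
    rcases whd_ne_of_whd_eq_app hw with ⟨n, h⟩ | ⟨d, e, h⟩ <;> simp [h, rootTree] at hT
  | appL N _ ih =>
    rw [tree_eq] at hT
    cases hw : a.whd <;> simp [hw, rootTree] at hT
    exact ih _ hT.1
  | appR N _ ih =>
    rw [tree_eq] at hT
    cases hw : a.whd <;> simp [hw, rootTree] at hT
    exact ih _ hT.2
  | lam _ ih =>
    rw [tree_eq] at hT
    cases hw : a.whd <;> simp [hw, rootTree] at hT
    exact ih _ hT
  | tau _ ih =>
    rw [tree_eq] at hT
    cases hw : a.whd <;> simp [hw, rootTree] at hT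
    exact ih _ hT

theorem isInfNormalFormOf_iff (a : FTerm) (T : CTerm) :
    T.IsInfNormalFormOf a.toCTerm ↔ T = a.tree :=
  ⟨fun h => eq_tree_of_infRed h.1 h.2, fun h => h ▸ ⟨infRed_tree a, isNormal_tree a⟩⟩

theorem clockedLevyTree_toCTerm (a : FTerm) : a.toCTerm.clockedLevyTree = a.tree := by
  have h : ∃ T : CTerm, T.IsInfNormalFormOf a.toCTerm := ⟨_, (isInfNormalFormOf_iff a _).2 rfl⟩
  exact (isInfNormalFormOf_iff a _).1 (Classical.epsilon_spec h)

end FTerm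

/-! ### The embedding of λ-terms in clocked terms. -/

namespace LTerm

/-- The inclusion of the λ-terms in the finite clocked terms. -/
def toFTerm : LTerm → FTerm
  | var n => .var n
  | app M N => .app M.toFTerm N.toFTerm
  | lam M => .lam M.toFTerm

theorem toCTerm_toFTerm (M : LTerm) : M.toFTerm.toCTerm = M.toCTerm := by
  induction M with
  | var n => rfl
  | app M N ihM ihN => simp [toFTerm, FTerm.toCTerm, toCTerm, ihM, ihN]
  | lam M ih => simp [toFTerm, FTerm.toCTerm, toCTerm, ih]

/-- Injectivity transfers the substitution laws from clocked terms to λ-terms. -/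
theorem toFTerm_injective {M N : LTerm} (h : M.toFTerm = N.toFTerm) : M = N := by
  induction M generalizing N with
  | var n => cases N <;> simp_all [toFTerm]
  | app M M' ihM ihM' =>
    cases N <;> simp [toFTerm] at h
    rw [ihM h.1, ihM' h.2]
  | lam M ih =>
    cases N <;> simp [toFTerm] at h
    rw [ih h]

theorem toFTerm_rename (ρ : ℕ → ℕ) (M : LTerm) :
    (rename ρ M).toFTerm = FTerm.rename ρ M.toFTerm := by
  induction M generalizing ρ with
  | var n => rfl
  | app M N ihM ihN => simp [rename, toFTerm, FTerm.rename, ihM, ihN]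
  | lam M ih => simp [rename, toFTerm, FTerm.rename, ih]

theorem toFTerm_up (σ : ℕ → LTerm) :
    (fun n => (up σ n).toFTerm) = FTerm.up (fun n => (σ n).toFTerm) := by
  funext n
  cases n with
  | zero => rfl
  | succ n => exact toFTerm_rename _ _

theorem toFTerm_subst (σ : ℕ → LTerm) (M : LTerm) :
    (subst σ M).toFTerm = FTerm.subst (fun n => (σ n).toFTerm) M.toFTerm := by
  induction M generalizing σ with
  | var n => rfl
  | app M N ihM ihN => simp [subst, toFTerm, FTerm.subst, ihM, ihN]
  | lam M ih => simp [subst, toFTerm, FTerm.subst, ih, toFTerm_up]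

theorem toFTerm_inst (M N : LTerm) : (inst M N).toFTerm = FTerm.inst M.toFTerm N.toFTerm := by
  unfold inst FTerm.inst
  rw [toFTerm_subst]
  congr 1
  funext n
  cases n <;> rfl

theorem rename_inst (ρ : ℕ → ℕ) (M N : LTerm) :
    rename ρ (inst M N) = inst (rename (upRen ρ) M) (rename ρ N) :=
  toFTerm_injective (by simp only [toFTerm_inst, toFTerm_rename, FTerm.rename_inst])

theorem subst_inst (σ : ℕ → LTerm) (M N : LTerm) :
    subst σ (inst M N) = inst (subst (up σ) M) (subst σ N) :=
  toFTerm_injective (by simp only [toFTerm_inst, toFTerm_subst, FTerm.subst_inst, toFTerm_up])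

/-! ### The Church–Rosser theorem -/

/-- Parallel β-reduction. -/
inductive Par : LTerm → LTerm → Prop
  | var (n : ℕ) : Par (var n) (var n)
  | app {M M' N N' : LTerm} : Par M M' → Par N N' → Par (app M N) (app M' N')
  | lam {M M' : LTerm} : Par M M' → Par (lam M) (lam M')
  | beta {M M' N N' : LTerm} : Par M M' → Par N N' → Par (app (lam M) N) (inst M' N')

theorem Par.refl (M : LTerm) : Par M M := by
  induction M with
  | var n => exact .var n
  | app M N ihM ihN => exact .app ihM ihN
  | lam M ih => exact .lam ih

theorem Par.rename {M M' : LTerm} (h : Par M M') (ρ : ℕ → ℕ) :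
    Par (rename ρ M) (rename ρ M') := by
  induction h generalizing ρ with
  | var n => exact .var _
  | app _ _ ih₁ ih₂ => exact .app (ih₁ ρ) (ih₂ ρ)
  | lam _ ih => exact .lam (ih _)
  | beta _ _ ih₁ ih₂ =>
    simp only [LTerm.rename, rename_inst]
    exact .beta (ih₁ _) (ih₂ ρ)

theorem Par.up {σ σ' : ℕ → LTerm} (h : ∀ n, Par (σ n) (σ' n)) (n : ℕ) :
    Par (up σ n) (up σ' n) := by
  cases n with
  | zero => exact .var 0
  | succ n => exact (h n).rename _

theorem Par.subst {M M' : LTerm} (h : Par M M') {σ σ' : ℕ → LTerm}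
    (hσ : ∀ n, Par (σ n) (σ' n)) : Par (subst σ M) (subst σ' M') := by
  induction h generalizing σ σ' with
  | var n => exact hσ n
  | app _ _ ih₁ ih₂ => exact .app (ih₁ hσ) (ih₂ hσ)
  | lam _ ih => exact .lam (ih (Par.up hσ))
  | beta _ _ ih₁ ih₂ =>
    simp only [LTerm.subst, subst_inst]
    exact .beta (ih₁ (Par.up hσ)) (ih₂ hσ)

theorem Par.inst {M M' N N' : LTerm} (hM : Par M M') (hN : Par N N') :
    Par (inst M N) (inst M' N') :=
  hM.subst fun n => by
    cases n with
    | zero => exact hN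
    | succ n => exact .var n

/-- The complete development of a term. -/
def development : LTerm → LTerm
  | var n => var n
  | lam M => lam (development M)
  | app M N =>
    match M, development M with
    | lam _, lam M' => inst M' (development N)
    | _, M' => app M' (development N)

/-- Takahashi's triangle property: the complete development depends only on the source, so it closes
every pair of parallel steps. -/
theorem Par.development {M N : LTerm} (h : Par M N) : Par N M.development := by
  induction h with
  | var n => exact .var n
  | lam _ ih => exact .lam ih
  | beta _ _ ih₁ ih₂ => exact ih₁.inst ih₂
  | @app M M' N N' hM hN ih₁ ih₂ =>
    cases M with
    | var n => exact .app ih₁ ih₂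
    | app P Q => exact .app ih₁ ih₂
    | lam P =>
      cases hM with
      | lam _ =>
        cases ih₁ with
        | lam h => exact .beta h ih₂

theorem Beta.par {M N : LTerm} (h : Beta M N) : Par M N := by
  induction h with
  | beta M N => exact .beta (.refl _) (.refl _)
  | appL N _ ih => exact .app ih (.refl _)
  | appR M _ ih => exact .app (.refl _) ih
  | lam _ ih => exact .lam ih

/-- `Red n M N`: the term `M` reduces to `N` in at most `n` steps. -/
inductive Red : ℕ → LTerm → LTerm → Prop
  | refl (n : ℕ) (M : LTerm) : Red n M M
  | head {n : ℕ} {M M' N : LTerm} : Beta M M' → Red n M' N → Red (n + 1) M N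

theorem Red.mono {m n : ℕ} {M N : LTerm} (h : Red m M N) (hmn : m ≤ n) : Red n M N := by
  induction h generalizing n with
  | refl m M => exact .refl _ _
  | head hs _ ih =>
    obtain ⟨n, rfl⟩ : ∃ k, n = k + 1 := ⟨n - 1, by omega⟩
    exact .head hs (ih (by omega))

theorem Red.trans {m n : ℕ} {M N P : LTerm} (h : Red m M N) (h' : Red n N P) :
    Red (m + n) M P := by
  induction h with
  | refl m M => exact h'.mono (by omega)
  | head hs _ ih => exact (Red.head hs (ih h')).mono (by omega)

theorem Red.lift {f : LTerm → LTerm} (hf : ∀ M N, Beta M N → Beta (f M) (f N)) {n : ℕ}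
    {M N : LTerm} (h : Red n M N) : Red n (f M) (f N) := by
  induction h with
  | refl n M => exact .refl _ _
  | head hs _ ih => exact .head (hf _ _ hs) ih

theorem Red.app {m n : ℕ} {M M' N N' : LTerm} (hM : Red m M M') (hN : Red n N N') :
    Red (m + n) (app M N) (app M' N') :=
  (hM.lift (f := fun M => LTerm.app M N) fun _ _ => .appL N).trans
    (hN.lift (f := LTerm.app M') fun _ _ => .appR M')

theorem Red.eq_of_zero {M N : LTerm} (h : Red 0 M N) : M = N := by cases h; rfl

theorem Red.eq_of_isNormal {n : ℕ} {M N : LTerm} (h : Red n M N) (hM : IsNormal M) : M = N := by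
  cases h with
  | refl => rfl
  | head hs _ => exact (hM _ hs).elim

theorem Red.reflTransGen {n : ℕ} {M N : LTerm} (h : Red n M N) : Relation.ReflTransGen Beta M N := by
  induction h with
  | refl => exact .refl
  | head hs _ ih => exact .head hs ih

theorem Par.exists_red {M N : LTerm} (h : Par M N) : ∃ n, Red n M N := by
  induction h with
  | var n => exact ⟨0, .refl _ _⟩
  | app _ _ ih₁ ih₂ =>
    obtain ⟨m, h₁⟩ := ih₁
    obtain ⟨n, h₂⟩ := ih₂
    exact ⟨_, h₁.app h₂⟩
  | lam _ ih =>
    obtain ⟨n, h⟩ := ih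
    exact ⟨n, h.lift fun _ _ => .lam⟩
  | beta _ _ ih₁ ih₂ =>
    obtain ⟨m, h₁⟩ := ih₁
    obtain ⟨n, h₂⟩ := ih₂
    exact ⟨_, ((h₁.lift fun _ _ => .lam).app h₂).trans (.head (.beta _ _) (.refl 0 _))⟩

theorem exists_red_of_reflTransGen_par {M N : LTerm} (h : Relation.ReflTransGen Par M N) :
    ∃ n, Red n M N := by
  induction h with
  | refl => exact ⟨0, .refl _ _⟩
  | tail _ hs ih =>
    obtain ⟨m, h₁⟩ := ih
    obtain ⟨n, h₂⟩ := hs.exists_red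
    exact ⟨_, h₁.trans h₂⟩

/-- The Church–Rosser theorem. -/
theorem BetaConv.exists_common_reduct {M N : LTerm} (h : BetaConv M N) :
    ∃ (L : LTerm) (m n : ℕ), Red m M L ∧ Red n N L := by
  have hjoin : Equivalence (Relation.Join (Relation.ReflTransGen Par)) :=
    Relation.equivalence_join_reflTransGen fun M _ _ h₁ h₂ =>
      ⟨M.development, .single h₁.development, .single h₂.development⟩
  have : Relation.Join (Relation.ReflTransGen Par) M N := by
    induction h with
    | rel _ N h => exact ⟨N, .single h.par, .refl⟩
    | refl M => exact hjoin.refl M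
    | symm _ _ _ ih => exact hjoin.symm ih
    | trans _ _ _ _ _ ih₁ ih₂ => exact hjoin.trans ih₁ ih₂
  obtain ⟨L, hM, hN⟩ := this
  obtain ⟨m, hm⟩ := exists_red_of_reflTransGen_par hM
  obtain ⟨n, hn⟩ := exists_red_of_reflTransGen_par hN
  exact ⟨L, m, n, hm, hn⟩

/-! ### Reductions of bounded length and substitution -/

theorem Beta.rename {M N : LTerm} (h : Beta M N) (ρ : ℕ → ℕ) :
    Beta (rename ρ M) (rename ρ N) := by
  induction h generalizing ρ with
  | beta M N => rw [rename_inst]; exact .beta _ _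
  | appL N _ ih => exact .appL _ (ih ρ)
  | appR M _ ih => exact .appR _ (ih ρ)
  | lam _ ih => exact .lam (ih _)

theorem Beta.subst {M N : LTerm} (h : Beta M N) (σ : ℕ → LTerm) :
    Beta (subst σ M) (subst σ N) := by
  induction h generalizing σ with
  | beta M N => rw [subst_inst]; exact .beta _ _
  | appL N _ ih => exact .appL _ (ih σ)
  | appR M _ ih => exact .appR _ (ih σ)
  | lam _ ih => exact .lam (ih _)

/-- Each occurrence of the variable `k` costs one step, and nothing else changes. -/
theorem red_subst_occ {σ σ' : ℕ → LTerm} {k : ℕ} (h : ∀ i, i ≠ k → σ i = σ' i)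
    (hk : Beta (σ k) (σ' k)) (M : LTerm) : Red (occ k M) (subst σ M) (subst σ' M) := by
  induction M generalizing σ σ' k with
  | var n =>
    by_cases hn : n = k
    · subst hn
      simp only [occ, if_pos, subst]
      exact .head hk (.refl 0 _)
    · simp only [subst, h n hn]
      exact .refl _ _
  | app M N ihM ihN => exact (ihM h hk).app (ihN h hk)
  | lam M ih =>
    refine (ih (fun i hi => ?_) (hk.rename _)).lift fun _ _ => .lam
    cases i with
    | zero => rfl
    | succ i => simp only [up, h i (by omega)]

theorem Red.inst_right_of_linear {M N N' : LTerm} (hM : occ 0 M ≤ 1) {n : ℕ} (h : Red n N N') :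
    Red n (inst M N) (inst M N') := by
  induction h with
  | refl => exact .refl _ _
  | @head n N N₁ N' hs _ ih =>
    have h₁ : Red (occ 0 M) (LTerm.inst M N) (LTerm.inst M N₁) := by
      refine red_subst_occ (k := 0) (fun i hi => ?_) hs M
      cases i with
      | zero => exact (hi rfl).elim
      | succ i => rfl
    exact (h₁.trans ih).mono (by omega)

/-- The additive bound is the point of simplicity: the steps of the argument are copied at most once
if the redex is linear, and there are none if the argument is normal. -/
theorem SimpleRedex.red_inst {M M' N N' : LTerm} (h : SimpleRedex M N) {m n : ℕ}
    (hM : Red m M M') (hN : Red n N N') : Red (m + n) (inst M N) (inst M' N') := by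
  -- The argument is reduced first, while the body is still `M`, to which the linearity hypothesis
  -- refers.
  have h₁ : Red n (inst M N) (inst M N') := by
    rcases h with h | h
    · exact hN.inst_right_of_linear h
    · rw [hN.eq_of_isNormal h]
      exact .refl _ _
  have h₂ : Red m (inst M N') (inst M' N') :=
    hM.lift (f := fun M => LTerm.inst M N') fun _ _ h => h.subst _
  exact (h₁.trans h₂).mono (by omega)

theorem Red.of_lam {n : ℕ} {M L : LTerm} (h : Red n (lam M) L) :
    ∃ M', L = LTerm.lam M' ∧ Red n M M' := by
  generalize hP : LTerm.lam M = P at h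
  induction h generalizing M with
  | refl n P => exact ⟨M, hP.symm, .refl _ _⟩
  | head hs _ ih =>
    subst hP
    cases hs with
    | lam hs =>
      obtain ⟨M', rfl, h⟩ := ih rfl
      exact ⟨M', rfl, .head hs h⟩

theorem Red.of_var {n k : ℕ} {L : LTerm} (h : Red n (var k) L) : L = LTerm.var k := by
  cases h with
  | refl => rfl
  | head hs _ => cases hs

/-- The reduction is cut at its first root contraction, if there is one; steps before it act on the
two sides independently, and the contraction accounts for the `+ 1`. -/
theorem Red.of_app {n : ℕ} {M N L : LTerm} (h : Red n (LTerm.app M N) L) :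
    (∃ M' N' i j, i + j ≤ n ∧ L = LTerm.app M' N' ∧ Red i M M' ∧ Red j N N') ∨
    (∃ P Q i j k, i + j + k + 1 ≤ n ∧ Red i M (lam P) ∧ Red j N Q ∧ Red k (inst P Q) L) := by
  generalize hP : LTerm.app M N = P at h
  induction h generalizing M N with
  | refl n P => exact .inl ⟨M, N, 0, 0, by omega, hP.symm, .refl _ _, .refl _ _⟩
  | head hs h ih =>
    subst hP
    cases hs with
    | beta P _ => exact .inr ⟨P, N, 0, 0, _, by omega, .refl _ _, .refl _ _, h⟩
    | appL _ hs =>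
      rcases ih rfl with ⟨M', N', i, j, hij, rfl, h₁, h₂⟩ | ⟨P, Q, i, j, k, hij, h₁, h₂, h₃⟩
      · exact .inl ⟨M', N', i + 1, j, by omega, rfl, .head hs h₁, h₂⟩
      · exact .inr ⟨P, Q, i + 1, j, k, by omega, .head hs h₁, h₂, h₃⟩
    | appR _ hs =>
      rcases ih rfl with ⟨M', N', i, j, hij, rfl, h₁, h₂⟩ | ⟨P, Q, i, j, k, hij, h₁, h₂, h₃⟩
      · exact .inl ⟨M', N', i, j + 1, by omega, rfl, h₁, .head hs h₂⟩
      · exact .inr ⟨P, Q, i, j + 1, k, by omega, h₁, .head hs h₂, h₃⟩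

/-! ### Weak head reduction -/

/-- One step of weak head reduction. -/
inductive Head : LTerm → LTerm → Prop
  | beta (M N : LTerm) : Head (app (lam M) N) (inst M N)
  | appL {M M' : LTerm} (R : LTerm) : Head M M' → Head (app M R) (app M' R)

theorem SimpleHead.head {M N : LTerm} (h : SimpleHead M N) : Head M N := by
  induction h with
  | beta M N _ => exact .beta M N
  | appL R _ ih => exact .appL R ih

theorem Head.beta_step {M N : LTerm} (h : Head M N) : Beta M N := by
  induction h with
  | beta M N => exact .beta M N
  | appL R _ ih => exact .appL R ih

/-- The projection of a reduction over a simple weak head step: the step is contracted in the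
reduction, which then gets shorter, or it has a residual in the target. -/
theorem SimpleHead.project {M M₁ : LTerm} (h : SimpleHead M M₁) {n : ℕ} {L : LTerm}
    (hL : Red n M L) : (∃ k < n, Red k M₁ L) ∨ ∃ L₁, Head L L₁ ∧ Red n M₁ L₁ := by
  induction h generalizing n L with
  | beta P Q hPQ =>
    rcases hL.of_app with ⟨M', N', i, j, hij, rfl, h₁, h₂⟩ | ⟨P', Q', i, j, k, hij, h₁, h₂, h₃⟩
    -- The redex is never contracted and survives at the root of `L`.
    · obtain ⟨P', rfl, h₁'⟩ := h₁.of_lam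
      exact .inr ⟨_, .beta _ _, (hPQ.red_inst h₁' h₂).mono hij⟩
    · obtain ⟨_, e, h₁'⟩ := h₁.of_lam
      cases e
      -- The reduction contracts this very redex, so its step is saved.
      exact .inl ⟨i + j + k, by omega, (hPQ.red_inst h₁' h₂).trans h₃⟩
  | appL R _ ih =>
    rcases hL.of_app with ⟨M', N', i, j, hij, rfl, h₁, h₂⟩ | ⟨P', Q', i, j, k, hij, h₁, h₂, h₃⟩
    · rcases ih h₁ with ⟨l, hl, h⟩ | ⟨L₁, hL₁, h⟩
      · exact .inl ⟨l + j, by omega, h.app h₂⟩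
      · exact .inr ⟨_, .appL _ hL₁, (h.app h₂).mono hij⟩
    · rcases ih h₁ with ⟨l, hl, h⟩ | ⟨L₁, hL₁, h⟩
      · exact .inl ⟨l + j + (k + 1), by omega, (h.app h₂).trans (.head (.beta _ _) h₃)⟩
      -- The function part has become an abstraction, which has no weak head step.
      · cases hL₁

/-- Terms of the form `y M₁ … Mₘ`. -/
inductive Neutral : LTerm → Prop
  | var (n : ℕ) : Neutral (var n)
  | app {M : LTerm} (N : LTerm) : Neutral M → Neutral (app M N)

theorem Neutral.red {n : ℕ} {M L : LTerm} (h : Neutral M) (hL : Red n M L) : Neutral L := by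
  induction h generalizing n L with
  | var k => rw [hL.of_var]; exact .var k
  | app N _ ih =>
    rcases hL.of_app with ⟨M', N', i, j, hij, rfl, h₁, h₂⟩ | ⟨P', Q', i, j, k, hij, h₁, h₂, h₃⟩
    · exact .app _ (ih h₁)
    · cases ih h₁

theorem apps_concat (M : LTerm) (Ms : List LTerm) (N : LTerm) :
    apps M (Ms ++ [N]) = app (apps M Ms) N := by
  simp [apps]

theorem neutral_apps (y : ℕ) (Ms : List LTerm) : Neutral (apps (var y) Ms) := by
  induction Ms using List.reverseRecOn with
  | nil => exact .var y
  | append_singleton Ms N ih => rw [apps_concat]; exact .app N ih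

theorem isWhnf_or_exists_head (M : LTerm) : IsWhnf M ∨ ∃ N, Head M N := by
  induction M with
  | var n => exact .inl (.inr ⟨n, [], rfl⟩)
  | lam M _ => exact .inl (.inl ⟨M, rfl⟩)
  | app M N ih _ =>
    rcases ih with (⟨M', rfl⟩ | ⟨y, Ms, rfl⟩) | ⟨M', h⟩
    · exact .inr ⟨_, .beta _ _⟩
    · exact .inl (.inr ⟨y, Ms ++ [N], (apps_concat _ _ _).symm⟩)
    · exact .inr ⟨_, .appL N h⟩

theorem HasWhnf.of_red {M N : LTerm} (h : Relation.ReflTransGen Beta M N) (hN : HasWhnf N) :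
    HasWhnf M := by
  obtain ⟨W, hW, hW'⟩ := hN
  exact ⟨W, h.trans hW, hW'⟩

theorem exists_head_of_not_hasWhnf {M : LTerm} (h : ¬ HasWhnf M) :
    ∃ N, Head M N ∧ ¬ HasWhnf N := by
  rcases isWhnf_or_exists_head M with hM | ⟨N, hN⟩
  · exact (h ⟨M, .refl, hM⟩).elim
  · exact ⟨N, hN, fun hW => h (hW.of_red (.single hN.beta_step))⟩

theorem Simple.clauses {M : LTerm} (h : Simple M) : SimpleClauses Simple M := by
  obtain ⟨S, hM, hS⟩ := h
  rcases hS M hM with h | ⟨M', h, h'⟩ | ⟨y, Ms, h, h'⟩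
  · exact .inl h
  · exact .inr (.inl ⟨M', h, S, h', hS⟩)
  · exact .inr (.inr ⟨y, Ms, h, fun M' hM' => ⟨S, h' M' hM', hS⟩⟩)

theorem simple_of_clauses {M : LTerm} (h : SimpleClauses Simple M) : Simple M := by
  refine ⟨SimpleClauses Simple, h, fun M' h' => ?_⟩
  rcases h' with h | ⟨N, h, h'⟩ | ⟨y, Ms, h, h'⟩
  · exact .inl h
  · exact .inr (.inl ⟨N, h, h'.clauses⟩)
  · exact .inr (.inr ⟨y, Ms, h, fun N hN => (h' N hN).clauses⟩)

/-- One step of the unfolding of the definition of simple terms. -/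
theorem Simple.cases {M : LTerm} (h : Simple M) :
    ¬ HasWhnf M ∨ (∃ M₁, SimpleHead M M₁ ∧ Simple M₁) ∨ (∃ M', M = lam M' ∧ Simple M') ∨
    (∃ y, M = var y) ∨ ∃ P Q, M = app P Q ∧ Neutral P ∧ Simple P ∧ Simple Q := by
  rcases h.clauses with h | ⟨M', h, h'⟩ | ⟨y, Ms, h, h'⟩
  · exact .inl h
  · rcases h.cases_head with rfl | ⟨M₁, hs, h⟩
    · exact .inr (.inr (.inl ⟨M', rfl, h'⟩))
    · exact .inr (.inl ⟨M₁, hs, simple_of_clauses (.inr (.inl ⟨M', h, h'⟩))⟩)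
  · rcases h.cases_head with rfl | ⟨M₁, hs, h⟩
    -- Splitting off the last argument leaves a neutral term whose arguments are still simple.
    · rcases List.eq_nil_or_concat Ms with rfl | ⟨Ns, N, rfl⟩
      · exact .inr (.inr (.inr (.inl ⟨y, rfl⟩)))
      · refine .inr (.inr (.inr (.inr ⟨_, N, by simpa using apps_concat _ Ns N, neutral_apps y Ns,
          simple_of_clauses (.inr (.inr ⟨y, Ns, .refl, fun M hM => h' M (by simp [hM])⟩)),
          h' N (by simp)⟩)))
    · exact .inr (.inl ⟨M₁, hs, simple_of_clauses (.inr (.inr ⟨y, Ms, h, h'⟩))⟩)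

/-! ### Clocked Lévy trees of λ-terms -/

/-- The clocked Lévy tree of a λ-term. -/
def tree (M : LTerm) : CTerm := M.toFTerm.tree

theorem tree_lam (M : LTerm) : (lam M).tree = .lam M.tree := FTerm.tree_eq _

/-- The shift rule carries the `τ` of the contraction out over the remaining arguments, so one head
step shows up as one `τ` at the root. -/
theorem Head.whd_toFTerm {M N : LTerm} (h : Head M N) : M.toFTerm.whd = .tau N.toFTerm := by
  induction h with
  | beta M N => simp only [toFTerm, FTerm.whd, toFTerm_inst]
  | appL R _ ih => simp only [toFTerm, FTerm.whd, ih]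

theorem Head.tree {M N : LTerm} (h : Head M N) : M.tree = .tau N.tree := by
  unfold LTerm.tree
  rw [FTerm.tree_eq, h.whd_toFTerm]
  rfl

theorem Neutral.whd_toFTerm {M : LTerm} (h : Neutral M) : M.toFTerm.whd = M.toFTerm := by
  induction h with
  | var n => rfl
  | app N h ih =>
    simp only [toFTerm, FTerm.whd, ih]
    cases h <;> rfl

theorem Neutral.tree_app {M : LTerm} (h : Neutral M) (N : LTerm) :
    (LTerm.app M N).tree = .app M.tree N.tree := by
  unfold LTerm.tree
  rw [FTerm.tree_eq, (Neutral.app N h).whd_toFTerm]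
  rfl

/-- Weak head reduction never stops on either side, so both trees consist of `τ`'s only. -/
theorem tree_eq_of_not_hasWhnf {M N : LTerm} (hM : ¬ HasWhnf M) (hN : ¬ HasWhnf N) :
    M.tree = N.tree := by
  refine CTerm.eq_of_bisim
    (fun S T => ∃ M N : LTerm, ¬ HasWhnf M ∧ ¬ HasWhnf N ∧ S = M.tree ∧ T = N.tree) ?_
    ⟨M, N, hM, hN, rfl, rfl⟩
  rintro _ _ ⟨M, N, hM, hN, rfl, rfl⟩
  obtain ⟨M', h, hM'⟩ := exists_head_of_not_hasWhnf hM
  obtain ⟨N', h', hN'⟩ := exists_head_of_not_hasWhnf hN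
  rw [h.tree, h'.tree]
  exact .tau ⟨M', N', hM', hN', rfl, rfl⟩

end LTerm

/-! ### τ-equivalence and its invariance under reduction of simple terms. -/

namespace CTerm

theorem TauEq.refl (M : CTerm) : TauEq M M := Relation.EqvGen.refl M

theorem TauEq.lift {f : CTerm → CTerm} (hf : ∀ M N, TauStep M N → TauStep (f M) (f N))
    {M N : CTerm} (h : TauEq M N) : TauEq (f M) (f N) := by
  induction h with
  | rel M N h => exact .rel _ _ (hf _ _ h)
  | refl M => exact .refl _
  | symm _ _ _ ih => exact .symm _ _ ih
  | trans _ _ _ _ _ ih₁ ih₂ => exact .trans _ _ _ ih₁ ih₂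

theorem TauEq.app {M M' N N' : CTerm} (hM : TauEq M M') (hN : TauEq N N') :
    TauEq (app M N) (app M' N') :=
  .trans _ _ _ (hM.lift (f := fun M => CTerm.app M N) fun _ _ => .appL N)
    (hN.lift (f := CTerm.app M') fun _ _ => .appR M')

end CTerm

namespace LTerm

open CTerm (TauEq)

/-- A reduction of a simple term changes the clocked Lévy tree by finitely many `τ`'s. -/
theorem Simple.tauEq_tree {n : ℕ} {M L : LTerm} (hM : Simple M) (hL : Red n M L) :
    TauEq M.tree L.tree := by
  induction n using Nat.strong_induction_on generalizing M L with
  | _ n ih =>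
  by_contra hne
  -- Failure of τ-equivalence is carried along in a bisimulation. Wherever the bound drops for all
  -- that remains to be compared, the induction hypothesis refutes it; the surviving cases match
  -- roots at the same bound `n`, so the trees would be equal. The disjunct `S = T` covers the side
  -- of an application that does not reduce.
  suffices h : M.tree = L.tree from hne (h ▸ TauEq.refl _)
  refine CTerm.eq_of_bisim (fun S T => S = T ∨ ∃ M L : LTerm, Simple M ∧ Red n M L ∧
    S = M.tree ∧ T = L.tree ∧ ¬ TauEq S T) ?_ (.inr ⟨M, L, hM, hL, rfl, rfl, hne⟩)
  clear hM hL hne M L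
  rintro S T (rfl | ⟨M, L, hM, hL, rfl, rfl, hne⟩)
  · exact .refl (fun _ => .inl rfl) _
  rcases hM.cases with hW | ⟨M₁, hs, hM₁⟩ | ⟨M', rfl, hM'⟩ | ⟨y, rfl⟩ | ⟨P, Q, rfl, hPn, hP, hQ⟩
  · refine (hne ?_).elim
    rw [tree_eq_of_not_hasWhnf hW fun h => hW (h.of_red hL.reflTransGen)]
    exact TauEq.refl _
  · rcases hs.project hL with ⟨k, hk, h⟩ | ⟨L₁, hL₁, h⟩
    · refine (hne ?_).elim
      rw [hs.head.tree]
      exact .trans _ _ _ (.rel _ _ (.drop _)) (ih k hk hM₁ h)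
    · rw [hs.head.tree, hL₁.tree] at hne ⊢
      exact .tau (.inr ⟨M₁, L₁, hM₁, h, rfl, rfl,
        fun h => hne (h.lift fun _ _ => .tau)⟩)
  · obtain ⟨L', rfl, h⟩ := hL.of_lam
    rw [tree_lam, tree_lam] at hne ⊢
    exact .lam (.inr ⟨M', L', hM', h, rfl, rfl, fun h => hne (h.lift fun _ _ => .lam)⟩)
  · rw [hL.of_var] at hne
    exact (hne (TauEq.refl _)).elim
  · rcases hL.of_app with ⟨P', Q', i, j, hij, rfl, h₁, h₂⟩ | ⟨_, _, _, _, _, _, h₁, _, _⟩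
    · rw [hPn.tree_app, (hPn.red h₁).tree_app] at hne ⊢
      -- As `i + j ≤ n`, either both sides have a smaller bound and the induction hypothesis
      -- applies, or one side keeps the whole bound and the other makes no step.
      by_cases hi : i < n
      · by_cases hj : j < n
        · exact (hne ((ih i hi hP h₁).app (ih j hj hQ h₂))).elim
        · obtain rfl : i = 0 := by omega
          rw [← h₁.eq_of_zero] at hne ⊢
          exact .app (.inl rfl) (.inr ⟨Q, Q', hQ, h₂.mono (by omega), rfl, rfl,
            fun h => hne ((TauEq.refl _).app h)⟩)
      · obtain rfl : j = 0 := by omega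
        rw [← h₂.eq_of_zero] at hne ⊢
        exact .app (.inr ⟨P, P', hP, h₁.mono (by omega), rfl, rfl,
          fun h => hne (h.app (TauEq.refl _))⟩) (.inl rfl)
    -- A neutral term never reduces to an abstraction.
    · cases hPn.red h₁

theorem existsUnique_isInfNormalFormOf (M : LTerm) :
    ∃! T : CTerm, T.IsInfNormalFormOf M.toCTerm := by
  rw [← toCTerm_toFTerm]
  exact ⟨_, (FTerm.isInfNormalFormOf_iff _ _).2 rfl,
    fun T hT => (FTerm.isInfNormalFormOf_iff _ _).1 hT⟩

theorem clockedLevyTree_toCTerm (M : LTerm) : M.toCTerm.clockedLevyTree = M.tree := by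
  rw [← toCTerm_toFTerm]
  exact FTerm.clockedLevyTree_toCTerm _

end LTerm

end ClockedLambda

/-- The first two conjuncts say that the clocked Lévy trees of `M` and `N` are well defined. -/
theorem mainTheorem5 (M N : ClockedLambda.LTerm) (hM : M.Simple) (hN : N.Simple) :
    (∃! T : ClockedLambda.CTerm, T.IsInfNormalFormOf M.toCTerm) ∧
    (∃! T : ClockedLambda.CTerm, T.IsInfNormalFormOf N.toCTerm) ∧
    (¬ M.toCTerm.EventuallyMatches N.toCTerm → ¬ M.BetaConv N) := by
  refine ⟨M.existsUnique_isInfNormalFormOf, N.existsUnique_isInfNormalFormOf, fun hne hconv => ?_⟩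
  obtain ⟨L, m, n, hm, hn⟩ := hconv.exists_common_reduct
  refine hne ?_
  unfold ClockedLambda.CTerm.EventuallyMatches
  rw [M.clockedLevyTree_toCTerm, N.clockedLevyTree_toCTerm]
  exact .trans _ _ _ (hM.tauEq_tree hm) (.symm _ _ (hN.tauEq_tree hn))
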